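/- Let $d,m\in\mathbb N$, let $\Psi_0\in\mathbb R^{m\times(d+m)}$ and $\Psi_1\in\mathbb R^{d\times(d+m)}$ be such that $\Sigma_0=\Psi_0\Psi_0^\top$ and $\Sigma_1=\Psi_1\Psi_1^\top$ are symmetric positive definite and such that the $d+m$ rows of $\Psi_0$ and $\Psi_1$ taken together are linearly independent. Let $\delta=\operatorname{diag}(\delta^1,\dots,\delta^d)$ with all $\delta^i>0$, and let $\gamma<0$. Put $\beta=\Psi_1\Psi_0^\top\Sigma_0^{-1}$, $$\Sigma_2=\Sigma_1-\Psi_1\Psi_0^\top\beta^\top,\qquad \Sigma_3=\Sigma_1-\Psi_1\Psi_0^\top\beta^\top-\beta\Psi_0\Psi_1^\top+\beta\Sigma_0\beta^\top,$$ $$Q_u=\tfrac{2\gamma}{1-\gamma}\Sigma_2^\top\Sigma_1^{-1}\Sigma_2+2\Sigma_3,\qquad A_u=-\tfrac{\gamma}{1-\gamma}\Sigma_2^\top\Sigma_1^{-1}\delta-\delta,\qquad P_u=\tfrac{\gamma}{2(1-\gamma)}\,\delta\,\Sigma_1^{-1}\delta .$$ A pair $(A,B)$ of real matrices with $A\in\mathbb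 R^{n\times n}$, $B\in\mathbb R^{n\times q}$ is *stabilisable* if there is a real matrix $M$ such that all eigenvalues of $A-BM$ have negative real parts. It is *controllable* if $[B,AB,\dots,A^{n-1}B]$ has rank $n$. A pair $(E,A)$ is *observable* if $(A^\top,E^\top)$ is controllable. Then: 1. $Q_u$ is symmetric positive definite. 2. There are $B_u,E_u,N_u\in\mathbb R^{d\times d}$, with $N_u$ symmetric positive definite, such that $Q_u=B_uN_u^{-1}B_u^\top$ and $-P_u=E_u^\top E_u$, the pair $(A_u,B_u)$ is stabilisable and the pair $(E_u,A_u)$ is observable. 3. For every $T\in\mathbb R$ the terminal value problem $$\frac{dC(t)}{dt}=-A_u^\top C(t)-C(t)A_u-C(t)Q_uC(t)-P_u\quad(t\le T),\qquad C(T)=0,$$ has exactly one solution $C:(-\infty,T]\to\mathbb R^{d\times d}$. This solution is symmetric negative semi-definite for every $t\le T$ and bounded on $(-\infty,T]$, and it has a unique limit $\bar C=\lim_{t\to-\infty}C(t)$. -/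

import Mathlib

open Set Filter Topology Matrix

namespace Cointegration

/-! ### Controllability, observability, stabilisability -/

/-- The controllability matrix `[B, A B, …, A^(n-1) B]`, with columns indexed by
pairs (block, column inside the block). -/
def controllabilityMatrix {n q : ℕ} (A : Matrix (Fin n) (Fin n) ℝ)
    (B : Matrix (Fin n) (Fin q) ℝ) : Matrix (Fin n) (Fin n × Fin q) ℝ :=
  Matrix.of fun i k => (A ^ (k.1 : ℕ) * B) i k.2

/-- `(A, B)` is controllable: the controllability matrix has rank `n`. -/
def IsControllable {n q : ℕ} (A : Matrix (Fin n) (Fin n) ℝ)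
    (B : Matrix (Fin n) (Fin q) ℝ) : Prop :=
  (controllabilityMatrix A B).rank = n

/-- `(E, A)` is observable: `(Aᵀ, Eᵀ)` is controllable. -/
def IsObservable {n q : ℕ} (E : Matrix (Fin q) (Fin n) ℝ)
    (A : Matrix (Fin n) (Fin n) ℝ) : Prop :=
  IsControllable Aᵀ Eᵀ

/-- `(A, B)` is stabilisable: for some real feedback matrix `M`, all (complex) eigenvalues of
`A - B M` have negative real part. -/
def IsStabilisable {n q : ℕ} (A : Matrix (Fin n) (Fin n) ℝ)
    (B : Matrix (Fin n) (Fin q) ℝ) : Prop :=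
  ∃ M : Matrix (Fin q) (Fin n) ℝ,
    ∀ z ∈ spectrum ℂ ((A - B * M).map (algebraMap ℝ ℂ)), z.re < 0

/-! ### Model matrices

`Ψ₀` is the volatility matrix of the `m` factors, `Ψ₁` that of the `d` stocks, both with respect
to `d + m` independent Brownian motions; `δ` is the vector of mean-reversion speeds and `γ` the
risk-aversion coefficient. -/

section Model

variable {d m : ℕ}

/-- Factor diffusion matrix `Σ₀ = Ψ₀ Ψ₀ᵀ`. -/
def Sigma0 (Ψ₀ : Matrix (Fin m) (Fin (d + m)) ℝ) : Matrix (Fin m) (Fin m) ℝ :=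
  Ψ₀ * Ψ₀ᵀ

/-- Stock diffusion matrix `Σ₁ = Ψ₁ Ψ₁ᵀ`. -/
def Sigma1 (Ψ₁ : Matrix (Fin d) (Fin (d + m)) ℝ) : Matrix (Fin d) (Fin d) ℝ :=
  Ψ₁ * Ψ₁ᵀ

/-- Factor loadings `β = Ψ₁ Ψ₀ᵀ Σ₀⁻¹`. -/
noncomputable def loadings (Ψ₀ : Matrix (Fin m) (Fin (d + m)) ℝ)
    (Ψ₁ : Matrix (Fin d) (Fin (d + m)) ℝ) : Matrix (Fin d) (Fin m) ℝ :=
  Ψ₁ * Ψ₀ᵀ * (Sigma0 Ψ₀)⁻¹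

/-- `Σ₂ = Σ₁ - Ψ₁ Ψ₀ᵀ βᵀ`. -/
noncomputable def Sigma2 (Ψ₀ : Matrix (Fin m) (Fin (d + m)) ℝ)
    (Ψ₁ : Matrix (Fin d) (Fin (d + m)) ℝ) : Matrix (Fin d) (Fin d) ℝ :=
  Sigma1 Ψ₁ - Ψ₁ * Ψ₀ᵀ * (loadings Ψ₀ Ψ₁)ᵀ

/-- `Σ₃ = Σ₁ - Ψ₁ Ψ₀ᵀ βᵀ - β Ψ₀ Ψ₁ᵀ + β Σ₀ βᵀ`. -/
noncomputable def Sigma3 (Ψ₀ : Matrix (Fin m) (Fin (d + m)) ℝ)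
    (Ψ₁ : Matrix (Fin d) (Fin (d + m)) ℝ) : Matrix (Fin d) (Fin d) ℝ :=
  Sigma1 Ψ₁ - Ψ₁ * Ψ₀ᵀ * (loadings Ψ₀ Ψ₁)ᵀ - loadings Ψ₀ Ψ₁ * Ψ₀ * Ψ₁ᵀ
    + loadings Ψ₀ Ψ₁ * Sigma0 Ψ₀ * (loadings Ψ₀ Ψ₁)ᵀ

/-- `Q_u = (2γ/(1-γ)) Σ₂ᵀ Σ₁⁻¹ Σ₂ + 2 Σ₃`. -/
noncomputable def Qu (Ψ₀ : Matrix (Fin m) (Fin (d + m)) ℝ)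
    (Ψ₁ : Matrix (Fin d) (Fin (d + m)) ℝ) (γ : ℝ) : Matrix (Fin d) (Fin d) ℝ :=
  (2 * γ / (1 - γ)) • ((Sigma2 Ψ₀ Ψ₁)ᵀ * (Sigma1 Ψ₁)⁻¹ * Sigma2 Ψ₀ Ψ₁)
    + (2 : ℝ) • Sigma3 Ψ₀ Ψ₁

/-- `A_u = -(γ/(1-γ)) Σ₂ᵀ Σ₁⁻¹ diag(δ) - diag(δ)`. -/
noncomputable def Au (Ψ₀ : Matrix (Fin m) (Fin (d + m)) ℝ)
    (Ψ₁ : Matrix (Fin d) (Fin (d + m)) ℝ) (δ : Fin d → ℝ) (γ : ℝ) :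
    Matrix (Fin d) (Fin d) ℝ :=
  -((γ / (1 - γ)) • ((Sigma2 Ψ₀ Ψ₁)ᵀ * (Sigma1 Ψ₁)⁻¹ * Matrix.diagonal δ))
    - Matrix.diagonal δ

/-- `P_u = (γ/(2(1-γ))) diag(δ) Σ₁⁻¹ diag(δ)`. -/
noncomputable def Pu (Ψ₁ : Matrix (Fin d) (Fin (d + m)) ℝ) (δ : Fin d → ℝ) (γ : ℝ) :
    Matrix (Fin d) (Fin d) ℝ :=
  (γ / (2 * (1 - γ))) • (Matrix.diagonal δ * (Sigma1 Ψ₁)⁻¹ * Matrix.diagonal δ)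

end Model

/-! ### The terminal value problem -/

/-- `C` solves `C'(t) = -Aᵀ C(t) - C(t) A - C(t) Q C(t) - P` on `(-∞, T]` with `C(T) = 0`.
The derivative is taken entrywise, and is one-sided at `T`. -/
def IsRiccatiSolution {n : ℕ} (A Q P : Matrix (Fin n) (Fin n) ℝ) (T : ℝ)
    (C : ℝ → Matrix (Fin n) (Fin n) ℝ) : Prop :=
  C T = 0 ∧ ∀ t ≤ T, ∀ i j,
    HasDerivWithinAt (fun s => C s i j)
      ((-(Aᵀ * C t) - C t * A - C t * Q * C t - P) i j) (Iic T) t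

end Cointegration

namespace Cointegration

/-! ### Matrix calculus and monotone matrix paths. -/

section Riccati

open scoped Matrix.Norms.Operator

variable {n : ℕ}

/-! Algebra: `Σ₃ = Σ₂ =: S`, the Gram matrix of the rows of `Ψ₁ - βΨ₀`, is positive definite by
independence of the rows, and `Σ₁ - S = βΣ₀βᵀ ≥ 0`. Hence `Q = 2(S - c S Σ₁⁻¹ S)` with `c = -γ/(1-γ)
< 1` is positive definite, and so is `R = -P`. With `B` and `E` invertible, stabilisability and
observability are immediate.

Analysis: `X t = -C (T - t)` turns the problem into `X' = AᵀX + XA - XQX + R`, `X 0 = 0`. This is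
linearised as `X = V U⁻¹`, where `U' = -AU + QV`, `V' = RU + AᵀV`, `U 0 = 1`, `V 0 = 0`.
Monotonicity of `UᵀV` keeps `U` invertible and gives `X ≥ 0` (`isUnit_hamiltonian`). The conserved
Hamiltonian gives `X' = U⁻ᵀ R U⁻¹ ≥ 0` (`conserved_hamiltonian`), and completing the square bounds
`X` above. A monotone bounded path of symmetric matrices converges, and Grönwall gives uniqueness.
-/

theorem hasDerivWithinAt_matrix_iff {C : ℝ → Matrix (Fin n) (Fin n) ℝ}
    {C' : Matrix (Fin n) (Fin n) ℝ} {s : Set ℝ} {t : ℝ} :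
    HasDerivWithinAt C C' s t ↔ ∀ i j, HasDerivWithinAt (fun u => C u i j) (C' i j) s t := by
  refine ⟨fun h i j => ?_, fun h => ?_⟩
  · exact (LinearMap.toContinuousLinearMap
      (Matrix.entryLinearMap ℝ ℝ i j)).hasFDerivAt.comp_hasDerivWithinAt t h
  · have key : ∀ M : Matrix (Fin n) (Fin n) ℝ, M = ∑ i, ∑ j, M i j • Matrix.single i j (1 : ℝ) := by
      intro M
      conv_lhs => rw [Matrix.matrix_eq_sum_single M]
      simp [Matrix.smul_single]
    rw [key C', show C = fun u => ∑ i, ∑ j, C u i j • Matrix.single i j (1 : ℝ) from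
      funext fun u => key (C u)]
    exact HasDerivWithinAt.fun_sum fun i _ => HasDerivWithinAt.fun_sum fun j _ =>
      (h i j).smul_const _

theorem hasDerivAt_matrix_iff {C : ℝ → Matrix (Fin n) (Fin n) ℝ}
    {C' : Matrix (Fin n) (Fin n) ℝ} {t : ℝ} :
    HasDerivAt C C' t ↔ ∀ i j, HasDerivAt (fun u => C u i j) (C' i j) t :=
  hasDerivWithinAt_univ.symm.trans (hasDerivWithinAt_matrix_iff.trans
    (forall₂_congr fun _ _ => hasDerivWithinAt_univ))

theorem hasDerivAt_matrix_transpose {C : ℝ → Matrix (Fin n) (Fin n) ℝ}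
    {C' : Matrix (Fin n) (Fin n) ℝ} {t : ℝ} (h : HasDerivAt C C' t) :
    HasDerivAt (fun u => (C u)ᵀ) C'ᵀ t :=
  hasDerivAt_matrix_iff.2 fun i j => hasDerivAt_matrix_iff.1 h j i

theorem hasDerivAt_quadForm {C : ℝ → Matrix (Fin n) (Fin n) ℝ}
    {C' : Matrix (Fin n) (Fin n) ℝ} {t : ℝ} (h : HasDerivAt C C' t) (x : Fin n → ℝ) :
    HasDerivAt (fun u => x ⬝ᵥ (C u *ᵥ x)) (x ⬝ᵥ (C' *ᵥ x)) t := by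
  simp only [dotProduct, mulVec]
  exact HasDerivAt.fun_sum fun i _ => (HasDerivAt.fun_sum fun j _ =>
    ((hasDerivAt_matrix_iff.1 h i j).mul_const _)).const_mul _

theorem hasDerivAt_matrix_inv {U : ℝ → Matrix (Fin n) (Fin n) ℝ}
    {U' : Matrix (Fin n) (Fin n) ℝ} {t : ℝ} (h : HasDerivAt U U' t) (hu : IsUnit (U t)) :
    HasDerivAt (fun s => (U s)⁻¹) (-((U t)⁻¹ * U' * (U t)⁻¹)) t := by
  obtain ⟨u, hu⟩ := hu
  have h1 := hasFDerivAt_ringInverse (𝕜 := ℝ) u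
  rw [hu] at h1
  have h2 := h1.comp_hasDerivAt t h
  have hinv : (↑u⁻¹ : Matrix (Fin n) (Fin n) ℝ) = (U t)⁻¹ := by
    rw [← hu, Matrix.coe_units_inv]
  rw [show (fun s => (U s)⁻¹) = Ring.inverse ∘ U from
    funext fun s => Matrix.nonsing_inv_eq_ringInverse _, ← hinv]
  exact h2

/-- Existence for an autonomous linear equation in a Banach space. -/
theorem exists_hasDerivAt_clm {F : Type*} [NormedAddCommGroup F] [NormedSpace ℝ F]
    [CompleteSpace F] (H : F →L[ℝ] F) (y₀ : F) :
    ∃ Y : ℝ → F, Y 0 = y₀ ∧ ∀ t, HasDerivAt Y (H (Y t)) t := by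
  refine ⟨fun t => NormedSpace.exp (t • H) y₀, by simp, fun t => ?_⟩
  simpa using! (hasDerivAt_exp_smul_const' (𝕂 := ℝ) H t).clm_apply (hasDerivAt_const t y₀)

/-- Existence for a linear system of two coupled equations in a Banach algebra. -/
theorem exists_linear_system {E : Type*} [NormedRing E] [NormedAlgebra ℝ E] [CompleteSpace E]
    (A B C D U₀ V₀ : E) :
    ∃ U V : ℝ → E, U 0 = U₀ ∧ V 0 = V₀ ∧
      (∀ t, HasDerivAt U (A * U t + B * V t) t) ∧ ∀ t, HasDerivAt V (C * U t + D * V t) t := by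
  let mulL (M : E) : E →L[ℝ] E := ContinuousLinearMap.mul ℝ E M
  let H : E × E →L[ℝ] E × E :=
    ((mulL A).comp (ContinuousLinearMap.fst ℝ E E) +
      (mulL B).comp (ContinuousLinearMap.snd ℝ E E)).prod
    ((mulL C).comp (ContinuousLinearMap.fst ℝ E E) +
      (mulL D).comp (ContinuousLinearMap.snd ℝ E E))
  obtain ⟨Y, hY0, hY⟩ := exists_hasDerivAt_clm H (U₀, V₀)
  refine ⟨fun t => (Y t).1, fun t => (Y t).2, by simp [hY0], by simp [hY0], fun t => ?_,
    fun t => ?_⟩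
  · exact (ContinuousLinearMap.fst ℝ E E).hasFDerivAt.comp_hasDerivAt t (hY t)
  · exact (ContinuousLinearMap.snd ℝ E E).hasFDerivAt.comp_hasDerivAt t (hY t)

theorem le_of_hasDerivAt_nonneg {f f' : ℝ → ℝ} {a b : ℝ} (hab : a ≤ b)
    (hf : ∀ t ∈ Icc a b, HasDerivAt f (f' t) t) (h : ∀ t ∈ Icc a b, 0 ≤ f' t) : f a ≤ f b := by
  refine monotoneOn_of_hasDerivWithinAt_nonneg (convex_Icc a b)
    (fun t ht => (hf t ht).continuousAt.continuousWithinAt)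
    (fun t ht => (hf t (interior_subset ht)).hasDerivWithinAt)
    (fun t ht => h t (interior_subset ht)) (left_mem_Icc.2 hab) (right_mem_Icc.2 hab) hab

theorem posSemidef_sub_of_hasDerivAt {M M' : ℝ → Matrix (Fin n) (Fin n) ℝ} {a b : ℝ} (hab : a ≤ b)
    (hM : ∀ t ∈ Icc a b, HasDerivAt M (M' t) t) (hpos : ∀ t ∈ Icc a b, (M' t).PosSemidef) :
    (M b - M a).PosSemidef := by
  have hsymm : ∀ t ∈ Icc a b, ∀ i j, M' t i j = M' t j i := fun t ht i j => by
    simpa using (hpos t ht).isHermitian.apply j i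
  -- `M a` need not be symmetric; used for `(i, j)` and `(j, i)`, this shows that the skew part is
  -- constant.
  have hle : ∀ i j, M a i j - M a j i ≤ M b i j - M b j i := fun i j =>
    le_of_hasDerivAt_nonneg (f := fun t => M t i j - M t j i) hab
      (fun t ht => (hasDerivAt_matrix_iff.1 (hM t ht) i j).sub
        (hasDerivAt_matrix_iff.1 (hM t ht) j i)) fun t ht => by simp [hsymm t ht i j]
  refine PosSemidef.of_dotProduct_mulVec_nonneg ?_ fun x => ?_
  · ext i j
    have h1 := hle i j
    have h2 := hle j i
    simp only [conjTranspose_apply, Matrix.sub_apply, star_trivial]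
    linarith
  · have := le_of_hasDerivAt_nonneg hab (fun t ht => hasDerivAt_quadForm (hM t ht) x)
      fun t ht => by simpa using (hpos t ht).dotProduct_mulVec_nonneg x
    simpa [sub_mulVec, dotProduct_sub] using this

theorem quadForm_polarization {M : Matrix (Fin n) (Fin n) ℝ} (hM : M.IsHermitian) (i j : Fin n) :
    M i j = ((Pi.single i 1 + Pi.single j 1) ⬝ᵥ (M *ᵥ (Pi.single i 1 + Pi.single j 1)) -
      Pi.single i 1 ⬝ᵥ (M *ᵥ Pi.single i 1) - Pi.single j 1 ⬝ᵥ (M *ᵥ Pi.single j 1)) / 2 := by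
  have : M j i = M i j := by simpa using hM.apply i j
  simp [mulVec_add, add_dotProduct, dotProduct_add, this]
  ring

/-- Testing `M` on `eᵢ ± eⱼ` bounds the entry by the mean of two diagonal entries of `M`, which
those of `K` dominate. -/
theorem abs_apply_le_of_posSemidef {M K : Matrix (Fin n) (Fin n) ℝ} (hM : M.PosSemidef)
    (hK : (K - M).PosSemidef) (i j : Fin n) : |M i j| ≤ (K i i + K j j) / 2 := by
  have hq := fun x => by simpa using hM.dotProduct_mulVec_nonneg x
  have h1 := hq (Pi.single i 1 + Pi.single j 1)
  have h2 := hq (Pi.single i 1 - Pi.single j 1)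
  have hs : M j i = M i j := by simpa using hM.isHermitian.apply i j
  have h3 := hK.diag_nonneg (i := i)
  have h4 := hK.diag_nonneg (i := j)
  simp [mulVec_add, mulVec_sub, add_dotProduct, sub_dotProduct, dotProduct_sub, hs] at h1 h2 h3 h4
  rw [abs_le]
  constructor <;> linarith

/-- Each quadratic form is monotone and bounded, hence converges; polarization recovers the entries.
-/
theorem exists_tendsto_of_posSemidef_mono {X : ℝ → Matrix (Fin n) (Fin n) ℝ}
    {K : Matrix (Fin n) (Fin n) ℝ} (hpos : ∀ t, 0 ≤ t → (X t).PosSemidef)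
    (hmono : ∀ s t, 0 ≤ s → s ≤ t → (X t - X s).PosSemidef)
    (hK : ∀ t, 0 ≤ t → (K - X t).PosSemidef) :
    ∃ L : Matrix (Fin n) (Fin n) ℝ, Tendsto X atTop (𝓝 L) := by
  have hq : ∀ x : Fin n → ℝ, ∃ l : ℝ, Tendsto (fun t => x ⬝ᵥ (X t *ᵥ x)) atTop (𝓝 l) := by
    intro x
    -- Clamping at `0` makes the form monotone on all of `ℝ`.
    have hmon : Monotone fun t => x ⬝ᵥ (X (max t 0) *ᵥ x) := fun s t hst => by
      have := (hmono (max s 0) (max t 0) (le_max_right _ _)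
        (max_le_max_right 0 hst)).dotProduct_mulVec_nonneg x
      simpa [sub_mulVec, dotProduct_sub] using this
    have hbdd : BddAbove (range fun t => x ⬝ᵥ (X (max t 0) *ᵥ x)) := by
      refine ⟨x ⬝ᵥ (K *ᵥ x), ?_⟩
      rintro _ ⟨t, rfl⟩
      have := (hK (max t 0) (le_max_right _ _)).dotProduct_mulVec_nonneg x
      simpa [sub_mulVec, dotProduct_sub] using this
    refine ⟨_, (tendsto_atTop_ciSup hmon hbdd).congr' ?_⟩
    filter_upwards [eventually_ge_atTop 0] with t ht
    rw [max_eq_left ht]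
  choose l hl using hq
  refine ⟨Matrix.of fun i j => (l (Pi.single i 1 + Pi.single j 1) - l (Pi.single i 1) -
    l (Pi.single j 1)) / 2, ?_⟩
  refine tendsto_pi_nhds.2 fun i => tendsto_pi_nhds.2 fun j => ?_
  refine ((((hl (Pi.single i 1 + Pi.single j 1)).sub (hl (Pi.single i 1))).sub
    (hl (Pi.single j 1))).div_const 2).congr' ?_
  filter_upwards [eventually_ge_atTop 0] with t ht
  exact (quadForm_polarization (hpos t ht).isHermitian i j).symm

/-! ### The Hamiltonian system behind the Riccati equation. -/

section Hamiltonian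

variable {A Q R : Matrix (Fin n) (Fin n) ℝ} {U V : ℝ → Matrix (Fin n) (Fin n) ℝ}

theorem hasDerivAt_transpose_mul_hamiltonian (hQ : Qᵀ = Q)
    (hU : ∀ t, HasDerivAt U (-A * U t + Q * V t) t)
    (hV : ∀ t, HasDerivAt V (R * U t + Aᵀ * V t) t) (t : ℝ) :
    HasDerivAt (fun s => (U s)ᵀ * V s) ((V t)ᵀ * Q * V t + (U t)ᵀ * R * U t) t := by
  convert! (hasDerivAt_matrix_transpose (hU t)).mul (hV t) using 1
  simp only [transpose_add, transpose_mul, transpose_neg, hQ]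
  noncomm_ring

theorem posSemidef_transpose_mul_hamiltonian (hQ : Q.PosDef) (hR : R.PosDef)
    (hU : ∀ t, HasDerivAt U (-A * U t + Q * V t) t)
    (hV : ∀ t, HasDerivAt V (R * U t + Aᵀ * V t) t) {s t : ℝ} (hst : s ≤ t) :
    ((U t)ᵀ * V t - (U s)ᵀ * V s).PosSemidef := by
  refine posSemidef_sub_of_hasDerivAt hst
    (fun r _ => hasDerivAt_transpose_mul_hamiltonian (by simpa using hQ.isHermitian.eq) hU hV r)
    fun r _ => ?_
  have h1 := hQ.posSemidef.conjTranspose_mul_mul_same (V r)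
  have h2 := hR.posSemidef.conjTranspose_mul_mul_same (U r)
  simpa using h1.add h2

/-- If `U t x = 0`, the nondecreasing function `s ↦ xᵀ(U s)ᵀ(V s)x` vanishes at both `0` and `t`,
hence on `[0, t]`. Its derivative at `0` is `xᵀRx`, so `x = 0`. -/
theorem isUnit_hamiltonian (hQ : Q.PosDef) (hR : R.PosDef) (hU0 : U 0 = 1) (hV0 : V 0 = 0)
    (hU : ∀ t, HasDerivAt U (-A * U t + Q * V t) t)
    (hV : ∀ t, HasDerivAt V (R * U t + Aᵀ * V t) t) {t : ℝ} (ht : 0 ≤ t) : IsUnit (U t) := by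
  rcases ht.eq_or_lt with rfl | ht
  · rw [hU0]; exact isUnit_one
  rw [← Matrix.mulVec_injective_iff_isUnit]
  refine (injective_iff_map_eq_zero (Matrix.mulVecLin (U t))).2 fun x hx => ?_
  rw [mulVecLin_apply] at hx
  by_contra hx0
  have hQs : Qᵀ = Q := by simpa using hQ.isHermitian.eq
  have hle : ∀ {a b : ℝ}, a ≤ b → x ⬝ᵥ (((U a)ᵀ * V a) *ᵥ x) ≤ x ⬝ᵥ (((U b)ᵀ * V b) *ᵥ x) := by
    intro a b hab
    simpa [sub_mulVec, dotProduct_sub] using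
      (posSemidef_transpose_mul_hamiltonian hQ hR hU hV hab).dotProduct_mulVec_nonneg x
  have hend : x ⬝ᵥ (((U t)ᵀ * V t) *ᵥ x) = 0 := by
    rw [← mulVec_mulVec, dotProduct_mulVec, vecMul_transpose, hx, zero_dotProduct]
  have hzero : ∀ s ∈ Icc 0 t, x ⬝ᵥ (((U s)ᵀ * V s) *ᵥ x) = 0 := fun s hs =>
    le_antisymm ((hle hs.2).trans hend.le) (by simpa [hV0] using hle hs.1)
  have hd := (hasDerivAt_quadForm (hasDerivAt_transpose_mul_hamiltonian hQs hU hV 0)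
    x).hasDerivWithinAt (s := Icc 0 t)
  have hd' : HasDerivWithinAt (fun s => x ⬝ᵥ (((U s)ᵀ * V s) *ᵥ x)) 0 (Icc 0 t) 0 :=
    (hasDerivWithinAt_const 0 (Icc 0 t) (0 : ℝ)).congr hzero (hzero 0 ⟨le_rfl, ht.le⟩)
  have heq := (uniqueDiffOn_Icc ht 0 ⟨le_rfl, ht.le⟩).eq_deriv _ hd hd'
  have hRx := hR.dotProduct_mulVec_pos hx0
  simp [hU0, hV0] at heq hRx
  exact hRx.ne' heq

theorem hasDerivAt_riccati (hU : ∀ t, HasDerivAt U (-A * U t + Q * V t) t)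
    (hV : ∀ t, HasDerivAt V (R * U t + Aᵀ * V t) t) {t : ℝ} (hu : IsUnit (U t)) :
    HasDerivAt (fun s => V s * (U s)⁻¹) (Aᵀ * (V t * (U t)⁻¹) + V t * (U t)⁻¹ * A -
      V t * (U t)⁻¹ * Q * (V t * (U t)⁻¹) + R) t := by
  have hui : U t * (U t)⁻¹ = 1 := Matrix.mul_nonsing_inv _ ((isUnit_iff_isUnit_det _).1 hu)
  convert! (hV t).mul (hasDerivAt_matrix_inv (hU t) hu) using 1
  calc _ = R * 1 + Aᵀ * V t * (U t)⁻¹ + V t * ((U t)⁻¹ * A * 1) -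
        V t * (U t)⁻¹ * Q * V t * (U t)⁻¹ := by noncomm_ring
    _ = _ := by rw [← hui]; noncomm_ring

/-- The left side is the quadratic Hamiltonian of the flow, constant in time. Conjugated by `U⁻¹` it
becomes `X' = U⁻ᵀ R U⁻¹`. -/
theorem conserved_hamiltonian (hQ : Qᵀ = Q) (hR : Rᵀ = R) (hU0 : U 0 = 1) (hV0 : V 0 = 0)
    (hU : ∀ t, HasDerivAt U (-A * U t + Q * V t) t)
    (hV : ∀ t, HasDerivAt V (R * U t + Aᵀ * V t) t) (t : ℝ) :
    (U t)ᵀ * (R * U t + Aᵀ * V t) + (V t)ᵀ * (A * U t - Q * V t) = R := by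
  have hd : ∀ t, HasDerivAt (fun t => (U t)ᵀ * (R * U t + Aᵀ * V t) +
      (V t)ᵀ * (A * U t - Q * V t)) 0 t := fun t => by
    convert! ((hasDerivAt_matrix_transpose (hU t)).mul
      (((hU t).const_mul R).add ((hV t).const_mul Aᵀ))).add
      ((hasDerivAt_matrix_transpose (hV t)).mul (((hU t).const_mul A).sub ((hV t).const_mul Q))) using 1
    simp only [transpose_add, transpose_mul, transpose_neg, hQ, hR, transpose_transpose,
      Pi.add_apply, Pi.sub_apply]
    noncomm_ring
  have := is_const_of_deriv_eq_zero (fun t => (hd t).differentiableAt) (fun t => (hd t).deriv) t 0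
  simpa [hU0, hV0] using this

end Hamiltonian

/-- A solution of the forward Riccati equation agrees with the one built from a Hamiltonian
system. -/
theorem riccati_eq_of_hamiltonian {A Q R : Matrix (Fin n) (Fin n) ℝ}
    {U V X : ℝ → Matrix (Fin n) (Fin n) ℝ} (hV0 : V 0 = 0)
    (hU : ∀ t, HasDerivAt U (-A * U t + Q * V t) t)
    (hV : ∀ t, HasDerivAt V (R * U t + Aᵀ * V t) t) (hX0 : X 0 = 0)
    (hX : ∀ t, 0 ≤ t → HasDerivWithinAt X (Aᵀ * X t + X t * A - X t * Q * X t + R) (Ici 0) t)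
    {t : ℝ} (ht : 0 ≤ t) : X t * U t = V t := by
  have hXc : ContinuousOn X (Icc 0 t) := fun s hs =>
    (hX s hs.1).continuousWithinAt.mono Icc_subset_Ici_self
  -- Grönwall for `W = XU - V`: `W' = (Aᵀ - XQ)W`, `W 0 = 0`, with coefficient bounded on `[0, t]`.
  obtain ⟨k, hk⟩ := isCompact_Icc.exists_bound_of_continuousOn
    ((continuousOn_const (c := Aᵀ)).sub (hXc.mul (continuousOn_const (c := Q))))
  have hW : ∀ s, 0 ≤ s → HasDerivWithinAt (fun s => X s * U s - V s)
      ((Aᵀ - X s * Q) * (X s * U s - V s)) (Ici 0) s := fun s hs => by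
    convert! ((hX s hs).mul (hU s).hasDerivWithinAt).sub (hV s).hasDerivWithinAt using 1
    noncomm_ring
  refine sub_eq_zero.1 (eq_zero_of_abs_deriv_le_mul_abs_self_of_eq_zero_right
    (f := fun s => X s * U s - V s) (K := k)
    (fun s hs => (hW s hs.1).continuousWithinAt.mono Icc_subset_Ici_self)
    (fun s hs => (hW s hs.1).mono (Ici_subset_Ici.2 hs.1)) (by simp [hX0, hV0])
    (fun s hs => (norm_mul_le _ _).trans ?_) t ⟨ht, le_rfl⟩)
  exact mul_le_mul_of_nonneg_right (hk s ⟨hs.1, hs.2.le⟩) (norm_nonneg _)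

theorem exists_riccati_solution {A Q R : Matrix (Fin n) (Fin n) ℝ} (hQ : Q.PosDef)
    (hR : R.PosDef) :
    ∃ X : ℝ → Matrix (Fin n) (Fin n) ℝ, X 0 = 0 ∧
      (∀ t, 0 ≤ t → HasDerivAt X (Aᵀ * X t + X t * A - X t * Q * X t + R) t) ∧
      (∀ t, 0 ≤ t → (X t).PosSemidef) ∧
      (∃ K : Matrix (Fin n) (Fin n) ℝ, ∀ t, 0 ≤ t → (K - X t).PosSemidef) ∧
      (∀ s t, 0 ≤ s → s ≤ t → (X t - X s).PosSemidef) ∧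
      ∀ Y : ℝ → Matrix (Fin n) (Fin n) ℝ, Y 0 = 0 →
        (∀ t, 0 ≤ t → HasDerivWithinAt Y (Aᵀ * Y t + Y t * A - Y t * Q * Y t + R) (Ici 0) t) →
        ∀ t, 0 ≤ t → Y t = X t := by
  have hQs : Qᵀ = Q := by simpa using hQ.isHermitian.eq
  have hRs : Rᵀ = R := by simpa using hR.isHermitian.eq
  obtain ⟨U, V, hU0, hV0, hU, hV⟩ := exists_linear_system (-A) Q R Aᵀ 1 0
  have hunit : ∀ {t : ℝ}, 0 ≤ t → IsUnit (U t) := isUnit_hamiltonian hQ hR hU0 hV0 hU hV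
  have hmi : ∀ {t : ℝ}, 0 ≤ t → U t * (U t)⁻¹ = 1 := fun ht =>
    Matrix.mul_nonsing_inv _ ((isUnit_iff_isUnit_det _).1 (hunit ht))
  have hmit : ∀ {t : ℝ}, 0 ≤ t → ((U t)⁻¹)ᵀ * (U t)ᵀ = 1 := fun ht => by
    rw [← transpose_mul, hmi ht, transpose_one]
  have hd := fun t (ht : (0 : ℝ) ≤ t) => hasDerivAt_riccati hU hV (hunit ht)
  have hpos : ∀ t, 0 ≤ t → (V t * (U t)⁻¹).PosSemidef := fun t ht => by
    have h := (posSemidef_transpose_mul_hamiltonian hQ hR hU hV ht).conjTranspose_mul_mul_same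
      (U t)⁻¹
    have e : ((U t)⁻¹)ᵀ * ((U t)ᵀ * V t) * (U t)⁻¹ = V t * (U t)⁻¹ := by
      rw [← mul_assoc, hmit ht, one_mul]
    simpa [hV0, e] using h
  have hderiv : ∀ t, 0 ≤ t → (Aᵀ * (V t * (U t)⁻¹) + V t * (U t)⁻¹ * A -
      V t * (U t)⁻¹ * Q * (V t * (U t)⁻¹) + R).PosSemidef := fun t ht => by
    have h := hR.posSemidef.conjTranspose_mul_mul_same (U t)⁻¹
    have hs : ((U t)⁻¹)ᵀ * (V t)ᵀ = V t * (U t)⁻¹ := by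
      simpa using (hpos t ht).isHermitian.eq
    rw [conjTranspose_eq_transpose_of_trivial] at h
    convert h using 1
    conv_rhs => rw [← conserved_hamiltonian hQs hRs hU0 hV0 hU hV t]
    calc _ = 1 * R * 1 + 1 * Aᵀ * (V t * (U t)⁻¹) + V t * (U t)⁻¹ * A * 1 -
        V t * (U t)⁻¹ * Q * (V t * (U t)⁻¹) := by noncomm_ring
      _ = ((U t)⁻¹)ᵀ * (U t)ᵀ * R * (U t * (U t)⁻¹) +
        ((U t)⁻¹)ᵀ * (U t)ᵀ * Aᵀ * (V t * (U t)⁻¹) +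
        ((U t)⁻¹)ᵀ * (V t)ᵀ * A * (U t * (U t)⁻¹) -
        ((U t)⁻¹)ᵀ * (V t)ᵀ * Q * (V t * (U t)⁻¹) := by rw [hmit ht, hmi ht, hs]
      _ = _ := by noncomm_ring
  refine ⟨fun t => V t * (U t)⁻¹, by simp [hV0], hd, hpos, ?_, ?_, ?_⟩
  · have hQi : Q * Q⁻¹ = 1 := Matrix.mul_nonsing_inv _ ((isUnit_iff_isUnit_det _).1 hQ.isUnit)
    -- Chosen so that `X' + (X - G)ᵀQ(X - G) = R + GᵀQG - 2X`; the left side is `≥ 0`, which bounds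
    -- `X`.
    set G := Q⁻¹ * (A + 1) with hG
    have hQG : Q * G = A + 1 := by rw [hG, ← mul_assoc, hQi, one_mul]
    have hGQ : Gᵀ * Q = Aᵀ + 1 := by
      rw [← hQs, ← transpose_mul, hQG, transpose_add, transpose_one]
    refine ⟨(2⁻¹ : ℝ) • (R + Gᵀ * Q * G), fun t ht => ?_⟩
    have hs : (V t * (U t)⁻¹)ᵀ = V t * (U t)⁻¹ := by simpa using (hpos t ht).isHermitian.eq
    have h1 := (hderiv t ht).add
      (hQ.posSemidef.conjTranspose_mul_mul_same (V t * (U t)⁻¹ - G))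
    rw [conjTranspose_eq_transpose_of_trivial, transpose_sub, hs] at h1
    have h2 := h1.smul (show (0 : ℝ) ≤ 2⁻¹ by norm_num)
    convert h2 using 1
    beta_reduce
    generalize V t * (U t)⁻¹ = X at hs h1 h2 ⊢
    have e : (X - Gᵀ) * Q * (X - G) =
        X * Q * X - X * (Q * G) - Gᵀ * Q * X + Gᵀ * Q * G := by noncomm_ring
    rw [e, hQG, hGQ]
    have e2 : Aᵀ * X + X * A - X * Q * X + R +
        (X * Q * X - X * (A + 1) - (Aᵀ + 1) * X + (Aᵀ + 1) * G) =
        R + (Aᵀ + 1) * G - (2 : ℝ) • X := by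
      rw [two_smul]; noncomm_ring
    rw [e2, smul_sub, smul_smul]
    norm_num
  · exact fun s t hs hst => posSemidef_sub_of_hasDerivAt hst (fun r hr => hd r (hs.trans hr.1))
      fun r hr => hderiv r (hs.trans hr.1)
  · intro Y hY0 hY t ht
    change Y t = V t * (U t)⁻¹
    rw [← riccati_eq_of_hamiltonian hV0 hU hV hY0 hY ht, mul_assoc, hmi ht, mul_one]

theorem isRiccatiSolution_iff {A Q P : Matrix (Fin n) (Fin n) ℝ} {T : ℝ}
    {C : ℝ → Matrix (Fin n) (Fin n) ℝ} :
    IsRiccatiSolution A Q P T C ↔ C T = 0 ∧ ∀ t ≤ T, HasDerivWithinAt C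
      (-(Aᵀ * C t) - C t * A - C t * Q * C t - P) (Iic T) t := by
  simp only [IsRiccatiSolution, hasDerivWithinAt_matrix_iff]

theorem exists_terminal_riccati_solution {A Q P : Matrix (Fin n) (Fin n) ℝ} (hQ : Q.PosDef)
    (hP : (-P).PosDef) (T : ℝ) :
    ∃ C : ℝ → Matrix (Fin n) (Fin n) ℝ, IsRiccatiSolution A Q P T C ∧
      (∀ t ≤ T, (-C t).PosSemidef) ∧
      (∃ K : ℝ, ∀ t ≤ T, ∀ i j, |C t i j| ≤ K) ∧
      (∀ C' : ℝ → Matrix (Fin n) (Fin n) ℝ, IsRiccatiSolution A Q P T C' →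
        Set.EqOn C' C (Set.Iic T)) ∧
      ∃ Cbar : Matrix (Fin n) (Fin n) ℝ, Tendsto C atBot (𝓝 Cbar) := by
  obtain ⟨X, hX0, hX, hpos, ⟨K, hK⟩, hmono, huniq⟩ := exists_riccati_solution (A := A) hQ hP
  refine ⟨fun t => -X (T - t), isRiccatiSolution_iff.2 ⟨by simp [hX0], fun t ht => ?_⟩,
    fun t ht => ?_, ?_, fun C' hC' => ?_, ?_⟩
  · have h1 := ((hX (T - t) (sub_nonneg.2 ht)).scomp t ((hasDerivAt_id t).const_sub T)).neg
    convert! h1.hasDerivWithinAt using 1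
    simp only [neg_smul, one_smul]
    noncomm_ring
  · simpa using hpos _ (sub_nonneg.2 ht)
  · refine ⟨∑ i, ∑ j, |(K i i + K j j) / 2|, fun t ht i j => ?_⟩
    have h1 := abs_apply_le_of_posSemidef (hpos _ (sub_nonneg.2 ht)) (hK _ (sub_nonneg.2 ht)) i j
    have h2 := Finset.single_le_sum (f := fun j => |(K i i + K j j) / 2|)
      (fun j _ => abs_nonneg _) (Finset.mem_univ j)
    have h3 := Finset.single_le_sum (f := fun i => ∑ j, |(K i i + K j j) / 2|)
      (fun i _ => Finset.sum_nonneg fun j _ => abs_nonneg _) (Finset.mem_univ i)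
    simpa using (h1.trans (le_abs_self _)).trans (h2.trans h3)
  · obtain ⟨h0, hC'⟩ := isRiccatiSolution_iff.1 hC'
    intro t ht
    have h1 := huniq (fun s => -C' (T - s)) (by simp [h0]) (fun s hs => ?_) (T - t)
      (sub_nonneg.2 ht)
    · simpa [neg_eq_iff_eq_neg] using h1
    · have hmaps : MapsTo (fun r => T - r) (Ici 0) (Iic T) := fun r hr => by
        simpa using hr
      have h2 := ((hC' (T - s) (by linarith)).scomp s
        ((hasDerivAt_id s).const_sub T).hasDerivWithinAt hmaps).neg
      convert! h2 using 1
      simp only [neg_smul, one_smul]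
      noncomm_ring
  · obtain ⟨L, hL⟩ := exists_tendsto_of_posSemidef_mono hpos hmono hK
    exact ⟨-L, (hL.comp (tendsto_atTop_add_const_left _ T tendsto_neg_atBot_atTop)).neg⟩

end Riccati

/-! ### Control-theoretic conditions and positive definiteness. -/

theorem isObservable_of_isUnit {n : ℕ} {E : Matrix (Fin n) (Fin n) ℝ} (hE : IsUnit E)
    (A : Matrix (Fin n) (Fin n) ℝ) : IsObservable E A := by
  refine le_antisymm ((rank_le_card_height _).trans_eq (Fintype.card_fin n)) ?_
  rcases Nat.eq_zero_or_pos n with rfl | hn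
  · simp
  -- The zeroth block `Eᵀ` alone has full rank.
  have hsub : (controllabilityMatrix Aᵀ Eᵀ).submatrix id (fun j => ((⟨0, hn⟩ : Fin n), j)) = Eᵀ := by
    ext i j
    simp [controllabilityMatrix]
  have hrank := rank_of_isUnit Eᵀ ((isUnit_transpose E).2 hE)
  rw [← hsub, Fintype.card_fin] at hrank
  exact hrank.symm.le.trans (rank_submatrix_le _ _ _)

theorem isStabilisable_of_isUnit {n : ℕ} {B : Matrix (Fin n) (Fin n) ℝ} (hB : IsUnit B)
    (A : Matrix (Fin n) (Fin n) ℝ) : IsStabilisable A B := by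
  -- This feedback makes the closed-loop matrix `-1`.
  refine ⟨B⁻¹ * (A + 1), fun z hz => ?_⟩
  rw [← mul_assoc, Matrix.mul_nonsing_inv _ ((isUnit_iff_isUnit_det _).1 hB), one_mul,
    sub_add_cancel_left] at hz
  have h1 : (-1 : Matrix (Fin n) (Fin n) ℝ).map (algebraMap ℝ ℂ) =
      algebraMap ℂ (Matrix (Fin n) (Fin n) ℂ) (-1) := by
    ext i j
    simp [Matrix.one_apply, Matrix.algebraMap_eq_diagonal, Matrix.diagonal_apply, apply_ite]
  rw [h1] at hz
  rcases subsingleton_or_nontrivial (Matrix (Fin n) (Fin n) ℂ) with h | h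
  · simp [spectrum.of_subsingleton] at hz
  · rw [spectrum.scalar_eq] at hz
    rw [mem_singleton_iff.1 hz]
    norm_num

theorem exists_isUnit_transpose_mul_self {n : ℕ} {P : Matrix (Fin n) (Fin n) ℝ} (hP : P.PosDef) :
    ∃ E : Matrix (Fin n) (Fin n) ℝ, IsUnit E ∧ P = Eᵀ * E := by
  open scoped MatrixOrder Matrix.Norms.L2Operator in
  obtain ⟨E, hE⟩ := CStarAlgebra.nonneg_iff_eq_star_mul_self.mp hP.posSemidef.nonneg
  rw [star_eq_conjTranspose, conjTranspose_eq_transpose_of_trivial] at hE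
  refine ⟨E, ?_, hE⟩
  have h := hP.isUnit
  rw [hE] at h
  rw [isUnit_iff_isUnit_det] at h ⊢
  rw [det_mul] at h
  exact isUnit_of_mul_isUnit_right h

/-- If `0 < S ≤ K` then `S - c S K⁻¹ S` is positive definite for `0 ≤ c < 1`. -/
theorem posDef_sub_smul_mul_inv_mul {n : ℕ} {S K : Matrix (Fin n) (Fin n) ℝ} (hS : S.PosDef)
    (hK : K.PosDef) (hSK : (K - S).PosSemidef) {c : ℝ} (hc0 : 0 ≤ c) (hc1 : c < 1) :
    (S - c • (S * K⁻¹ * S)).PosDef := by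
  have hSs : Sᵀ = S := by simpa using hS.isHermitian.eq
  have hKs : (K⁻¹)ᵀ = K⁻¹ := by simpa using hK.inv.isHermitian.eq
  have hi : K⁻¹ * K = 1 := Matrix.nonsing_inv_mul _ ((isUnit_iff_isUnit_det _).1 hK.isUnit)
  have h1 := hS.posSemidef.conjTranspose_mul_mul_same (1 - K⁻¹ * S)
  have h2 := hSK.conjTranspose_mul_mul_same (K⁻¹ * S)
  -- `S - cSK⁻¹S = (1-c)S + c[(1-K⁻¹S)ᵀS(1-K⁻¹S) + (K⁻¹S)ᵀ(K-S)K⁻¹S]`.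
  have h := (hS.smul (sub_pos.2 hc1)).add_posSemidef ((h1.add h2).smul hc0)
  convert h using 1
  simp only [conjTranspose_eq_transpose_of_trivial, transpose_sub, transpose_mul, transpose_one,
    hSs, hKs]
  have e : (1 - S * K⁻¹) * S * (1 - K⁻¹ * S) + S * K⁻¹ * (K - S) * (K⁻¹ * S) =
      S - 2 • (S * K⁻¹ * S) + S * (K⁻¹ * K) * K⁻¹ * S := by noncomm_ring
  rw [e, hi, mul_one, two_smul, sub_smul, one_smul, ← sub_sub, sub_add_cancel, smul_sub]
  abel

/-! ### Positivity of the model matrices. -/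

section Model

variable {d m : ℕ} {Ψ₀ : Matrix (Fin m) (Fin (d + m)) ℝ} {Ψ₁ : Matrix (Fin d) (Fin (d + m)) ℝ}

theorem loadings_mul_Sigma0 (hS₀ : (Sigma0 Ψ₀).PosDef) :
    loadings Ψ₀ Ψ₁ * Sigma0 Ψ₀ = Ψ₁ * Ψ₀ᵀ := by
  rw [loadings, Matrix.mul_assoc, Matrix.nonsing_inv_mul _ ((isUnit_iff_isUnit_det _).1 hS₀.isUnit),
    Matrix.mul_one]

theorem loadings_mul_transpose (hS₀ : (Sigma0 Ψ₀).PosDef) :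
    loadings Ψ₀ Ψ₁ * Ψ₀ * Ψ₁ᵀ = Ψ₁ * Ψ₀ᵀ * (loadings Ψ₀ Ψ₁)ᵀ := by
  have hs : (Sigma0 Ψ₀)ᵀ = Sigma0 Ψ₀ := by simpa using hS₀.isHermitian.eq
  have h : (Ψ₁ * Ψ₀ᵀ)ᵀ = Sigma0 Ψ₀ * (loadings Ψ₀ Ψ₁)ᵀ := by
    rw [← loadings_mul_Sigma0 hS₀, transpose_mul, hs]
  rw [transpose_mul, transpose_transpose] at h
  rw [Matrix.mul_assoc, h, ← Matrix.mul_assoc, loadings_mul_Sigma0 hS₀]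

theorem Sigma3_eq_Sigma2 (hS₀ : (Sigma0 Ψ₀).PosDef) : Sigma3 Ψ₀ Ψ₁ = Sigma2 Ψ₀ Ψ₁ := by
  rw [Sigma3, Sigma2, loadings_mul_Sigma0 hS₀, loadings_mul_transpose hS₀]
  abel

theorem Sigma3_eq_mul_transpose : Sigma3 Ψ₀ Ψ₁ =
    (Ψ₁ - loadings Ψ₀ Ψ₁ * Ψ₀) * (Ψ₁ - loadings Ψ₀ Ψ₁ * Ψ₀)ᵀ := by
  simp only [Sigma3, Sigma1, Sigma0, transpose_sub, transpose_mul, Matrix.mul_sub, Matrix.sub_mul,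
    Matrix.mul_assoc]
  abel

theorem posDef_Sigma2 (hS₀ : (Sigma0 Ψ₀).PosDef)
    (hΨ : LinearIndependent ℝ (Matrix.fromRows Ψ₀ Ψ₁).row) : (Sigma2 Ψ₀ Ψ₁).PosDef := by
  rw [← Sigma3_eq_Sigma2 hS₀, Sigma3_eq_mul_transpose, ← conjTranspose_eq_transpose_of_trivial]
  refine PosDef.mul_conjTranspose_self _ ?_
  rw [← Matrix.vecMul_injective_iff] at hΨ
  intro x y hxy
  -- `x(Ψ₁ - βΨ₀)` is the combination of all rows with coefficients `-xβ` on `Ψ₀` and `x` on `Ψ₁`.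
  have h := @hΨ (Sum.elim (-(x ᵥ* loadings Ψ₀ Ψ₁)) x) (Sum.elim (-(y ᵥ* loadings Ψ₀ Ψ₁)) y) (by
    simpa [sumElim_vecMul_fromRows, vecMul_sub, vecMul_vecMul, neg_vecMul, neg_add_eq_sub]
      using hxy)
  funext i
  simpa using congrFun h (Sum.inr i)

theorem posSemidef_Sigma1_sub_Sigma2 (hS₀ : (Sigma0 Ψ₀).PosDef) :
    (Sigma1 Ψ₁ - Sigma2 Ψ₀ Ψ₁).PosSemidef := by
  rw [Sigma2, sub_sub_cancel, ← loadings_mul_Sigma0 hS₀]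
  simpa using hS₀.posSemidef.mul_mul_conjTranspose_same (loadings Ψ₀ Ψ₁)

theorem posDef_Qu (hS₀ : (Sigma0 Ψ₀).PosDef) (hS₁ : (Sigma1 Ψ₁).PosDef)
    (hΨ : LinearIndependent ℝ (Matrix.fromRows Ψ₀ Ψ₁).row) {γ : ℝ} (hγ : γ < 0) :
    (Qu Ψ₀ Ψ₁ γ).PosDef := by
  have hS := posDef_Sigma2 hS₀ hΨ
  have hs : (Sigma2 Ψ₀ Ψ₁)ᵀ = Sigma2 Ψ₀ Ψ₁ := by simpa using hS.isHermitian.eq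
  have h1γ : 0 < 1 - γ := by linarith
  have h := (posDef_sub_smul_mul_inv_mul hS hS₁ (posSemidef_Sigma1_sub_Sigma2 hS₀)
    (c := -γ / (1 - γ)) (div_nonneg (by linarith) h1γ.le)
    ((div_lt_one h1γ).2 (by linarith))).smul (two_pos (α := ℝ))
  convert h using 1
  rw [Qu, Sigma3_eq_Sigma2 hS₀, hs, smul_sub, smul_smul, eq_sub_iff_add_eq, add_right_comm, ← add_smul,
    show 2 * γ / (1 - γ) + 2 * (-γ / (1 - γ)) = 0 by ring, zero_smul, zero_add]

theorem posDef_neg_Pu (hS₁ : (Sigma1 Ψ₁).PosDef) {δ : Fin d → ℝ} (hδ : ∀ i, 0 < δ i) {γ : ℝ}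
    (hγ : γ < 0) : (-Pu Ψ₁ δ γ).PosDef := by
  have h1γ : 0 < 1 - γ := by linarith
  have hu : IsUnit (Matrix.diagonal δ) := (PosDef.diagonal hδ).isUnit
  have h := (hS₁.inv.conjTranspose_mul_mul_same (mulVec_injective_iff_isUnit.2 hu)).smul
    (show 0 < -γ / (2 * (1 - γ)) from div_pos (by linarith) (by linarith))
  rw [diagonal_conjTranspose, star_trivial] at h
  rwa [Pu, ← neg_smul, ← neg_div]

end Model

end Cointegration

theorem mainTheorem1 {d m : ℕ}
    (Ψ₀ : Matrix (Fin m) (Fin (d + m)) ℝ) (Ψ₁ : Matrix (Fin d) (Fin (d + m)) ℝ)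
    (δ : Fin d → ℝ) (γ : ℝ)
    (hS₀ : (Cointegration.Sigma0 Ψ₀).PosDef) (hS₁ : (Cointegration.Sigma1 Ψ₁).PosDef)
    (hΨ : LinearIndependent ℝ (Matrix.fromRows Ψ₀ Ψ₁).row)
    (hδ : ∀ i, 0 < δ i) (hγ : γ < 0) :
    (Cointegration.Qu Ψ₀ Ψ₁ γ).PosDef ∧
    (∃ B E N : Matrix (Fin d) (Fin d) ℝ,
      N.PosDef ∧
      Cointegration.Qu Ψ₀ Ψ₁ γ = B * N⁻¹ * Bᵀ ∧
      -Cointegration.Pu Ψ₁ δ γ = Eᵀ * E ∧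
      Cointegration.IsStabilisable (Cointegration.Au Ψ₀ Ψ₁ δ γ) B ∧
      Cointegration.IsObservable E (Cointegration.Au Ψ₀ Ψ₁ δ γ)) ∧
    (∀ T : ℝ, ∃ C : ℝ → Matrix (Fin d) (Fin d) ℝ,
      Cointegration.IsRiccatiSolution (Cointegration.Au Ψ₀ Ψ₁ δ γ)
        (Cointegration.Qu Ψ₀ Ψ₁ γ) (Cointegration.Pu Ψ₁ δ γ) T C ∧
      (∀ t ≤ T, (-C t).PosSemidef) ∧
      (∃ K : ℝ, ∀ t ≤ T, ∀ i j, |C t i j| ≤ K) ∧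
      (∀ C' : ℝ → Matrix (Fin d) (Fin d) ℝ,
        Cointegration.IsRiccatiSolution (Cointegration.Au Ψ₀ Ψ₁ δ γ)
          (Cointegration.Qu Ψ₀ Ψ₁ γ) (Cointegration.Pu Ψ₁ δ γ) T C' →
        Set.EqOn C' C (Set.Iic T)) ∧
      ∃! Cbar : Matrix (Fin d) (Fin d) ℝ, Filter.Tendsto C Filter.atBot (𝓝 Cbar)) := by
  have hQ := Cointegration.posDef_Qu hS₀ hS₁ hΨ hγ
  have hP := Cointegration.posDef_neg_Pu hS₁ hδ hγ
  obtain ⟨E, hE, hPE⟩ := Cointegration.exists_isUnit_transpose_mul_self hP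
  -- `B = N = Q` works, since `Q Q⁻¹ Qᵀ = Q`.
  refine ⟨hQ, ⟨Cointegration.Qu Ψ₀ Ψ₁ γ, E, Cointegration.Qu Ψ₀ Ψ₁ γ, hQ, ?_, hPE,
    Cointegration.isStabilisable_of_isUnit hQ.isUnit _,
    Cointegration.isObservable_of_isUnit hE _⟩, fun T => ?_⟩
  · rw [Matrix.mul_nonsing_inv _ ((isUnit_iff_isUnit_det _).1 hQ.isUnit), Matrix.one_mul]
    simpa using hQ.isHermitian.eq.symm
  · obtain ⟨C, hC, hneg, hbdd, huniq, L, hL⟩ :=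
      Cointegration.exists_terminal_riccati_solution
        (A := Cointegration.Au Ψ₀ Ψ₁ δ γ) hQ hP T
    exact ⟨C, hC, hneg, hbdd, huniq, L, hL, fun L' hL' => tendsto_nhds_unique hL' hL⟩
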